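/- Let $K$ be an algebraically closed field of characteristic zero, let $n\ge 1$, let $A=K[x_1,\dots,x_n]$, and let $W_n$ be the Lie algebra over $K$ of all $K$-derivations of $A$, with bracket $[D_1,D_2]=D_1\circ D_2-D_2\circ D_1$. For an integer $i\ge -1$ let $$W_n^{[i]}=\Big\{\sum_{j=1}^n f_j\frac{\partial}{\partial x_j} : \text{each } f_j\in A \text{ is zero or homogeneous of degree } i+1\Big\}.$$ Let $E_n=\sum_{i=1}^n x_i\frac{\partial}{\partial x_i}$ be the Euler derivation, and let $N_1=W_n^{[1]}\cap AE_n$ be the set of elements of $W_n^{[1]}$ that are polynomial multiples of $E_n$; that is, $N_1=\{\ell E_n : \ell\in A \text{ zero or homogeneous of degree } 1\}$. A maximal subalgebra of $W_n$ is a proper Lie subalgebra that is contained in no other proper Lie subalgebra. Then the sum $L=W_n^{[-1]}\oplus W_n^{[0]}\oplus N_1$ is direct, and $L$ is a finite-dimensional maximal subalgebra of $W_n$. Conversely, every finite-dimensional maximal subalgebra of $W_n$ that contains $W_n^{[0]}$ is equal to $L$. -/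

import Mathlib

/-- The Lie algebra `W_n(K)` of all `K`-derivations of `K[x_1, ..., x_n]`, with the commutator
bracket. -/
abbrev Wn (K : Type*) [Field K] (n : ℕ) : Type _ :=
  Derivation K (MvPolynomial (Fin n) K) (MvPolynomial (Fin n) K)

namespace Wn

/-- The component `W_n^{[i]}` of the standard grading: the derivations `∑ j, f j • ∂/∂x_j`
(where `f j = D (X j)`) such that every `f j` is zero or homogeneous of degree `i + 1`.
It is zero for `i < -1`. -/
def homog (K : Type*) [Field K] (n : ℕ) (i : ℤ) : Submodule K (Wn K n) where
  carrier := {D | ∀ (j : Fin n) (m : Fin n →₀ ℕ),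
    MvPolynomial.coeff m (D (MvPolynomial.X j)) ≠ 0 → (m.degree : ℤ) = i + 1}
  zero_mem' := by
    intro j m h
    simp at h
  add_mem' := by
    intro D D' hD hD' j m h
    by_cases h0 : MvPolynomial.coeff m (D (MvPolynomial.X j)) = 0
    · refine hD' j m ?_
      intro h1
      exact h (by simp [h0, h1])
    · exact hD j m h0
  smul_mem' := by
    intro c D hD j m h
    refine hD j m ?_
    intro h0
    exact h (by simp [h0])

/-- The Euler derivation `E_n = ∑ i, x_i ∂/∂x_i`. -/
noncomputable def euler (K : Type*) [Field K] (n : ℕ) : Wn K n :=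
  ∑ i : Fin n, (MvPolynomial.X i : MvPolynomial (Fin n) K) • MvPolynomial.pderiv i

/-- `N_i`: the elements of `W_n^{[i]}` that are polynomial multiples of the Euler derivation. -/
noncomputable def eulerMultiples (K : Type*) [Field K] (n : ℕ) (i : ℤ) : Submodule K (Wn K n) :=
  homog K n i ⊓
    (Submodule.span (MvPolynomial (Fin n) K) {euler K n}).restrictScalars K

end Wn

/-!
The derivations `x^α ∂/∂x_j` form a basis of `W_n` and have an explicit bracket (`lie_monoDer`).

A subalgebra `M` containing `W_n^{[0]} ≅ gl_n` contains the diagonal torus `⟨x_k ∂/∂x_k⟩`, so it is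
spanned by weight vectors. These are the `x^α ∂/∂x_j` with `α_j = 0`, and the
`x^β ∑ c_j x_j ∂/∂x_j` (`exists_weight_vector`). In particular, if `M` is not contained in `L`, it
contains a weight vector outside `L`.

Suppose that `M` also contains `W_n^{[-1]}`, that it is not contained in `L`, and that `n ≥ 2`. If
the weight vector found is `x^β ∑ c_j x_j ∂/∂x_j` with `c` not constant, then applying
`ad (x_i ∂/∂x_j)` with `c_i ≠ c_j` repeatedly gives a monomial derivation along `∂/∂x_j`
(`exists_monoDer_of_torusMul`); if `c` is constant, the vector is a multiple of `x^β E` with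
`|β| ≥ 2`, and a bracket with some `∂/∂x_b` leads back to the other cases. Thus `M` contains a
monomial derivation of degree at least one (`exists_monoDer_mem`), and hence, lowering the degree
with the `∂/∂x_k` and moving variables with `gl_n`, all `x_a² ∂/∂x_b` with `a ≠ b`. There are two
consequences.

* If `M` contains `N_1`, then `M = W_n`: comparing the brackets
  `2 x_c x_d ∂/∂x_d - x_c² ∂/∂x_c` with `x_c E` gives all quadratic fields, and brackets with
  `x_l E` then raise the degree (`eq_top_of_not_le`). So `L` is maximal.
* In any case `M` is infinite-dimensional, as bracketing with
  `2 x_a x_b ∂/∂x_b - x_a² ∂/∂x_a` turns `x_a^k ∂/∂x_b` into a nonzero multiple of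
  `x_a^{k+1} ∂/∂x_b` (`not_finiteDimensional`).

For `n = 1` such an `M` is all of `W_1` (`eq_top_of_subsingleton`).

Now let `T` be a finite-dimensional maximal subalgebra containing `W_n^{[0]}`. If all its elements
vanished at the origin, `T` would be the infinite-dimensional subalgebra `vanishingAtZero`; so some
weight vector of `T` lies in `W_n^{[-1]}`, and `gl_n` moves it to all of `W_n^{[-1]}`
(`homog_neg_one_le_of_isCoatom`). By the above `T` is contained in `L`, and so equals it.
-/

namespace Wn

open MvPolynomial
open Finsupp (single degree)

variable {K : Type*} [Field K] {n : ℕ}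

/-! ### Monomial derivations -/

/-- The derivation `x^α ∂/∂x_j`. -/
noncomputable def monoDer (K : Type*) [Field K] {n : ℕ} (α : Fin n →₀ ℕ) (j : Fin n) : Wn K n :=
  monomial α (1 : K) • pderiv j

theorem monoDer_apply_X (α : Fin n →₀ ℕ) (j k : Fin n) :
    monoDer K α j (X k) = if k = j then monomial α 1 else 0 := by
  simp only [monoDer, Derivation.smul_apply, pderiv_X, Pi.single_apply, smul_eq_mul]
  split_ifs <;> simp

/-- The bracket of two monomial derivations. The truncated subtractions are harmless: where they
truncate, the coefficient in front vanishes. -/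
theorem lie_monoDer (α β : Fin n →₀ ℕ) (i j : Fin n) :
    ⁅monoDer K α i, monoDer K β j⁆ =
      (β i : K) • monoDer K (α + (β - single i 1)) j
        - (α j : K) • monoDer K (β + (α - single j 1)) i := by
  refine MvPolynomial.derivation_ext fun k => ?_
  have h (γ δ : Fin n →₀ ℕ) (l m : Fin n) : monoDer K γ l (if k = m then monomial δ 1 else 0) =
      (δ l : K) • (if k = m then monomial (γ + (δ - single l 1)) 1 else 0) := by
    split_ifs with hk
    · simp [monoDer, pderiv_monomial, monomial_mul, smul_monomial]
    · simp
  simp only [Derivation.commutator_apply, monoDer_apply_X, Derivation.sub_apply,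
    Derivation.smul_apply, h]

theorem exists_add_single {α : Fin n →₀ ℕ} {j : Fin n} (h : α j ≠ 0) :
    ∃ γ, α = γ + single j 1 :=
  ⟨α - single j 1,
    (tsub_add_cancel_of_le (Finsupp.single_le_iff.2 (Nat.one_le_iff_ne_zero.2 h))).symm⟩

theorem exists_add_single_of_degree {α : Fin n →₀ ℕ} {d : ℕ} (h : α.degree = d + 1) :
    ∃ γ k, α = γ + single k 1 ∧ γ.degree = d := by
  obtain ⟨k, hk⟩ : ∃ k, α k ≠ 0 := by
    by_contra! hcon
    have : α = 0 := Finsupp.ext hcon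
    simp [this] at h
  obtain ⟨γ, rfl⟩ := exists_add_single hk
  exact ⟨γ, k, rfl, by simpa using h⟩

theorem eq_sum_monoDer (D : Wn K n) :
    D = ∑ i ∈ Finset.univ.sigma (fun j : Fin n => (D (X j)).support),
      coeff i.2 (D (X i.1)) • monoDer K i.2 i.1 := by
  refine MvPolynomial.derivation_ext fun k => ?_
  rw [Finset.sum_sigma, ← Derivation.coeFnAddMonoidHom_apply (∑ _ ∈ _, _), map_sum, Finset.sum_apply]
  simp only [map_sum, Finset.sum_apply, Derivation.coeFnAddMonoidHom_apply, Derivation.smul_apply,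
    monoDer_apply_X]
  rw [Finset.sum_eq_single k]
  · simp only [if_true, smul_monomial, smul_eq_mul, mul_one]
    exact (support_sum_monomial_coeff _).symm
  · intro j _ hj
    simp [hj.symm]
  · simp

theorem monoDer_mem_homog {i : ℤ} {α : Fin n →₀ ℕ} (h : (α.degree : ℤ) = i + 1) (j : Fin n) :
    monoDer K α j ∈ homog K n i := by
  intro k m hm
  rw [monoDer_apply_X] at hm
  split_ifs at hm
  · rw [coeff_monomial] at hm
    split_ifs at hm with h'
    · rw [← h', h]
    · simp at hm
  · simp at hm

theorem homog_le_iff {i : ℤ} {N : Submodule K (Wn K n)} :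
    homog K n i ≤ N ↔ ∀ (α : Fin n →₀ ℕ) (j : Fin n), (α.degree : ℤ) = i + 1 → monoDer K α j ∈ N := by
  refine ⟨fun h α j hα => h (monoDer_mem_homog hα j), fun h D hD => ?_⟩
  rw [eq_sum_monoDer D]
  refine Submodule.sum_mem _ fun s hs => N.smul_mem _ (h _ _ ?_)
  simp only [Finset.mem_sigma, Finset.mem_univ, true_and, MvPolynomial.mem_support_iff] at hs
  exact hD _ _ hs

theorem eq_top_of_monoDer_mem {M : LieSubalgebra K (Wn K n)} (h : ∀ α j, monoDer K α j ∈ M) :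
    M = ⊤ := by
  refine eq_top_iff.2 fun D _ => ?_
  rw [eq_sum_monoDer D]
  exact M.toSubmodule.sum_mem fun s _ => M.toSubmodule.smul_mem _ (h _ _)

instance finiteDimensional_homog (i : ℤ) : FiniteDimensional K (homog K n i) := by
  have hfin : {α : Fin n →₀ ℕ | (α.degree : ℤ) = i + 1}.Finite := by
    refine (Finsupp.finite_of_degree_le (σ := Fin n) (i + 1).toNat).subset fun α hα => ?_
    simp only [Set.mem_ofPred_eq] at hα ⊢
    omega
  have hfin' := Set.Finite.image2 (fun α j => monoDer K α j) hfin (Set.finite_univ (α := Fin n))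
  have := FiniteDimensional.span_of_finite K hfin'
  refine Submodule.finiteDimensional_of_le (homog_le_iff.2 fun α j h => ?_ :
    homog K n i ≤ Submodule.span K (Set.image2 (fun α j => monoDer K α j)
      {α : Fin n →₀ ℕ | (α.degree : ℤ) = i + 1} Set.univ))
  refine Submodule.subset_span (Set.mem_image2.2 ⟨α, ?_, j, Set.mem_univ j, rfl⟩)
  simpa using h

/-- A finite-dimensional subalgebra does not contain `x_a^k ∂/∂x_b` for all large `k`, as these are
linearly independent. -/
theorem not_finiteDimensional_of_pow_mem {M : LieSubalgebra K (Wn K n)} (a b : Fin n) (m : ℕ)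
    (h : ∀ k, monoDer K (single a (m + k)) b ∈ M) : ¬ FiniteDimensional K M := by
  intro hfin
  let v : ℕ → M := fun k => ⟨_, h k⟩
  let φ : M →ₗ[K] MvPolynomial (Fin n) K :=
    { toFun := fun D => (D : Wn K n) (X b)
      map_add' := fun _ _ => rfl
      map_smul' := fun _ _ => rfl }
  have hv : LinearIndependent K v := by
    refine LinearIndependent.of_comp φ ?_
    have h1 := (basisMonomials (Fin n) K).linearIndependent.comp
      (fun k : ℕ => single a (m + k)) (fun k l hkl => by
        have := DFunLike.congr_fun hkl a
        simpa using this)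
    have h2 : φ ∘ v = basisMonomials (Fin n) K ∘ fun k : ℕ => single a (m + k) := by
      ext1 k
      simp [φ, v, monoDer_apply_X]
    rw [h2]
    exact h1
  exact Set.infinite_univ (α := ℕ) (Set.finite_univ_iff.2 hv.finite)

/-! ### The Euler derivation -/

theorem euler_apply (p : MvPolynomial (Fin n) K) :
    euler K n p = ∑ i, X i * pderiv i p := by
  rw [euler, ← Derivation.coeFnAddMonoidHom_apply (∑ _ ∈ _, _), map_sum, Finset.sum_apply]
  rfl

theorem euler_apply_X (k : Fin n) : euler K n (X k) = X k := by
  simp [euler_apply, pderiv_X, Pi.single_apply]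

theorem lie_smul_euler (D : Wn K n) (f : MvPolynomial (Fin n) K) :
    ⁅D, f • euler K n⁆ = D f • euler K n + f • ⁅D, euler K n⁆ := by
  refine MvPolynomial.derivation_ext fun k => ?_
  simp only [Derivation.commutator_apply, Derivation.add_apply, Derivation.smul_apply,
    Derivation.leibniz, smul_eq_mul]
  ring

/-- `ad E` acts on `W_n^{[i]}` as multiplication by `i`. -/
theorem euler_lie {i : ℤ} {D : Wn K n} (hD : D ∈ homog K n i) : ⁅euler K n, D⁆ = (i : K) • D := by
  refine MvPolynomial.derivation_ext fun k => ?_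
  rw [Derivation.commutator_apply, euler_apply_X, Derivation.smul_apply, euler_apply]
  by_cases h0 : D (X k) = 0
  · simp [h0]
  obtain ⟨m, hm⟩ := ne_zero_iff.1 h0
  have hh : (D (X k)).IsHomogeneous m.degree := by
    intro m' hm'
    have h1 := hD k m hm
    have h2 := hD k m' hm'
    have hw : Finsupp.weight (1 : Fin n → ℕ) m' = m'.degree :=
      (DFunLike.congr_fun Finsupp.degree_eq_weight_one m').symm
    rw [hw]
    have : (m'.degree : ℤ) = m.degree := by rw [h1, h2]
    exact_mod_cast this
  rw [hh.sum_X_mul_pderiv]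
  have h1 := hD k m hm
  have h2 : i = (m.degree : ℤ) - 1 := by omega
  rw [h2]
  simp [sub_smul, Nat.cast_smul_eq_nsmul]

theorem lie_homog_mem {i j : ℤ} {D D' : Wn K n} (hD : D ∈ homog K n i) (hD' : D' ∈ homog K n j) :
    ⁅D, D'⁆ ∈ homog K n (i + j) := by
  have key (α β : Fin n →₀ ℕ) (a b : Fin n) (hα : (α.degree : ℤ) = i + 1)
      (hβ : (β.degree : ℤ) = j + 1) : ⁅monoDer K α a, monoDer K β b⁆ ∈ homog K n (i + j) := by
    rw [lie_monoDer]
    refine sub_mem ?_ ?_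
    · by_cases h : β a = 0
      · simp [h]
      · obtain ⟨γ, rfl⟩ := exists_add_single h
        refine Submodule.smul_mem _ _ (monoDer_mem_homog ?_ _)
        simp at hβ ⊢
        omega
    · by_cases h : α b = 0
      · simp [h]
      · obtain ⟨γ, rfl⟩ := exists_add_single h
        refine Submodule.smul_mem _ _ (monoDer_mem_homog ?_ _)
        simp at hα ⊢
        omega
  have h1 (α : Fin n →₀ ℕ) (a : Fin n) (hα : (α.degree : ℤ) = i + 1) :
      homog K n j ≤ (homog K n (i + j)).comap (LieAlgebra.ad K (Wn K n) (monoDer K α a)) :=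
    homog_le_iff.2 fun β b hβ => key α β a b hα hβ
  have h2 : homog K n i ≤ (homog K n (i + j)).comap (LieAlgebra.ad K (Wn K n) D') := by
    refine homog_le_iff.2 fun α a hα => ?_
    rw [Submodule.mem_comap, LieAlgebra.ad_apply, ← lie_skew]
    exact neg_mem (h1 α a hα hD')
  rw [← lie_skew]
  exact neg_mem (h2 hD)

/-! ### The subalgebra `L` -/

theorem lie_euler_eq_zero {D : Wn K n} (hD : D ∈ homog K n 0) : ⁅D, euler K n⁆ = 0 := by
  rw [← lie_skew, euler_lie hD]
  simp

theorem lie_eulerMultiples_mem {D D' : Wn K n} (hD : D ∈ homog K n 0)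
    (hD' : D' ∈ eulerMultiples K n 1) : ⁅D, D'⁆ ∈ eulerMultiples K n 1 := by
  obtain ⟨h1, h2⟩ := hD'
  refine ⟨by simpa using lie_homog_mem hD h1, ?_⟩
  obtain ⟨f, rfl⟩ := Submodule.mem_span_singleton.1 h2
  rw [lie_smul_euler, lie_euler_eq_zero hD, smul_zero, add_zero]
  exact Submodule.smul_mem _ _ (Submodule.mem_span_singleton_self _)

theorem lie_eulerMultiples_eq_zero {D D' : Wn K n} (hD : D ∈ eulerMultiples K n 1)
    (hD' : D' ∈ eulerMultiples K n 1) : ⁅D, D'⁆ = 0 := by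
  obtain ⟨h1, h2⟩ := hD
  obtain ⟨h1', h2'⟩ := hD'
  obtain ⟨f, rfl⟩ := Submodule.mem_span_singleton.1 h2
  obtain ⟨g, rfl⟩ := Submodule.mem_span_singleton.1 h2'
  -- The degree-one condition enters as `⁅E, ℓE⁆ = ℓE`, that is `E(ℓ)E = ℓE`.
  have hf : euler K n f • euler K n = f • euler K n := by simpa using euler_lie h1
  have hg : euler K n g • euler K n = g • euler K n := by simpa using euler_lie h1'
  rw [lie_smul_euler, ← lie_skew (f • _) (euler K n), lie_smul_euler, lie_self, smul_zero, add_zero, hf,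
    Derivation.smul_apply, smul_eq_mul, mul_smul, hg, smul_neg, ← mul_smul, ← mul_smul,
    mul_comm f g, add_neg_cancel]

/-- `W_n^{[-2]} = 0`. -/
theorem homog_neg_two : homog K n (-2) = ⊥ := by
  refine le_bot_iff.1 (homog_le_iff.2 fun α j h => ?_)
  omega

theorem lie_mem_sup {D D' : Wn K n}
    (hD : D ∈ homog K n (-1) ⊔ homog K n 0 ⊔ eulerMultiples K n 1)
    (hD' : D' ∈ homog K n (-1) ⊔ homog K n 0 ⊔ eulerMultiples K n 1) :
    ⁅D, D'⁆ ∈ homog K n (-1) ⊔ homog K n 0 ⊔ eulerMultiples K n 1 := by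
  obtain ⟨_, hab, c, hc, rfl⟩ := Submodule.mem_sup.1 hD
  obtain ⟨a, ha, b, hb, rfl⟩ := Submodule.mem_sup.1 hab
  obtain ⟨_, hab', c', hc', rfl⟩ := Submodule.mem_sup.1 hD'
  obtain ⟨a', ha', b', hb', rfl⟩ := Submodule.mem_sup.1 hab'
  have haa : ⁅a, a'⁆ = 0 := by
    have h := lie_homog_mem ha ha'
    rw [show (-1 : ℤ) + -1 = -2 by norm_num, homog_neg_two] at h
    exact h
  have hba : ⁅b, a'⁆ ∈ homog K n (-1) := lie_homog_mem hb ha'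
  have hab : ⁅a, b'⁆ ∈ homog K n (-1) := lie_homog_mem ha hb'
  have hbb : ⁅b, b'⁆ ∈ homog K n 0 := lie_homog_mem hb hb'
  have hac : ⁅a, c'⁆ ∈ homog K n 0 := lie_homog_mem ha hc'.1
  have hca : ⁅c, a'⁆ ∈ homog K n 0 := lie_homog_mem hc.1 ha'
  have hbc : ⁅b, c'⁆ ∈ eulerMultiples K n 1 := lie_eulerMultiples_mem hb hc'
  have hcb : ⁅c, b'⁆ ∈ eulerMultiples K n 1 := by
    rw [← lie_skew]
    exact neg_mem (lie_eulerMultiples_mem hb' hc)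
  have hcc : ⁅c, c'⁆ = 0 := lie_eulerMultiples_eq_zero hc hc'
  have h : ⁅a + b + c, a' + b' + c'⁆ =
      (⁅a, b'⁆ + ⁅b, a'⁆) + (⁅a, c'⁆ + ⁅b, b'⁆ + ⁅c, a'⁆) + (⁅b, c'⁆ + ⁅c, b'⁆) := by
    simp only [LieRing.add_lie, LieRing.lie_add, haa, hcc]
    abel
  rw [h]
  exact Submodule.add_mem_sup (Submodule.add_mem_sup (add_mem hab hba)
    (add_mem (add_mem hac hbb) hca)) (add_mem hbc hcb)

/-- The subalgebra `L = W_n^{[-1]} + W_n^{[0]} + N_1`. -/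
noncomputable def projSubalgebra (K : Type*) [Field K] (n : ℕ) : LieSubalgebra K (Wn K n) where
  toSubmodule := homog K n (-1) ⊔ homog K n 0 ⊔ eulerMultiples K n 1
  lie_mem' := lie_mem_sup

theorem iSupIndep_components [CharZero K] :
    iSupIndep ![homog K n (-1), homog K n 0, eulerMultiples K n 1] := by
  have h := (LieAlgebra.ad K (Wn K n) (euler K n)).eigenspaces_iSupIndep
  have hinj : Function.Injective ![(-1 : K), 0, 1] := by
    intro i j hij
    fin_cases i <;> fin_cases j <;> simp_all [neg_eq_iff_eq_neg]
    all_goals exact one_ne_zero (self_eq_neg.1 hij)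
  refine (h.comp hinj).mono fun i => ?_
  fin_cases i
  · intro D hD
    refine Module.End.mem_eigenspace_iff.2 ?_
    change ⁅euler K n, D⁆ = (-1 : K) • D
    simpa only [Int.cast_neg, Int.cast_one] using euler_lie (i := -1) hD
  · intro D hD
    refine Module.End.mem_eigenspace_iff.2 ?_
    change ⁅euler K n, D⁆ = (0 : K) • D
    simpa only [Int.cast_zero] using euler_lie (i := 0) hD
  · intro D hD
    refine Module.End.mem_eigenspace_iff.2 ?_
    change ⁅euler K n, D⁆ = (1 : K) • D
    simpa only [Int.cast_one] using euler_lie (i := 1) hD.1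

instance finiteDimensional_projSubalgebra : FiniteDimensional K (projSubalgebra K n) := by
  have : FiniteDimensional K (eulerMultiples K n 1) :=
    Submodule.finiteDimensional_of_le (inf_le_left (b := (Submodule.span _ _).restrictScalars K))
  exact inferInstanceAs (FiniteDimensional K
    (homog K n (-1) ⊔ homog K n 0 ⊔ eulerMultiples K n 1 : Submodule K (Wn K n)))

/-! ### Weight vectors of the diagonal torus -/

/-- A subspace stable under a family of endomorphisms contains the simultaneous weight components
of each of its elements. -/
theorem sum_weight_mem {ι κ V : Type*} [AddCommGroup V] [Module K V]
    (f : κ → V →ₗ[K] V) (p : Submodule K V) (hp : ∀ k, ∀ x ∈ p, f k x ∈ p)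
    [DecidableEq (κ → K)] (ω : ι → κ → K) (w : κ → K) (S : Finset ι) :
    ∀ v : ι → V, (∀ i k, f k (v i) = ω i k • v i) → ∑ i ∈ S, v i ∈ p →
      ∑ i ∈ S with ω i = w, v i ∈ p := by
  classical
  induction S using Finset.strongInduction with
  | H S ih =>
    intro v hv hS
    by_cases hall : ∀ i ∈ S, ω i = w
    · rwa [Finset.filter_true_of_mem hall]
    push Not at hall
    obtain ⟨i₀, hi₀, hne⟩ := hall
    obtain ⟨k, hk⟩ := Function.ne_iff.1 hne
    -- `f k - ω i₀ k` kills the weight of `i₀` and rescales the component of weight `w`.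
    have hss : S.filter (fun i => ω i k ≠ ω i₀ k) ⊂ S :=
      Finset.filter_ssubset.2 ⟨i₀, hi₀, by simp⟩
    have h1 := ih _ hss (fun i => (ω i k - ω i₀ k) • v i)
      (fun i l => by rw [map_smul, hv, smul_comm]) (by
        rw [Finset.sum_filter_of_ne (p := fun i => ω i k ≠ ω i₀ k)]
        · have : ∑ i ∈ S, (ω i k - ω i₀ k) • v i =
              f k (∑ i ∈ S, v i) - ω i₀ k • ∑ i ∈ S, v i := by
            simp only [map_sum, hv, Finset.smul_sum, sub_smul, Finset.sum_sub_distrib]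
          rw [this]
          exact sub_mem (hp k _ hS) (p.smul_mem _ hS)
        · intro i _ h0 heq
          exact h0 (by rw [heq, sub_self, zero_smul]))
    have h2 : ∑ i ∈ (S.filter fun i => ω i k ≠ ω i₀ k) with ω i = w, (ω i k - ω i₀ k) • v i =
        (w k - ω i₀ k) • ∑ i ∈ S with ω i = w, v i := by
      rw [Finset.smul_sum, Finset.filter_filter]
      refine Finset.sum_congr ?_ fun i hi => ?_
      · ext i
        simp only [Finset.mem_filter]
        constructor
        · rintro ⟨h, _, h'⟩
          exact ⟨h, h'⟩
        · rintro ⟨h, rfl⟩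
          exact ⟨h, hk.symm, rfl⟩
      · rw [(Finset.mem_filter.1 hi).2]
    rw [h2] at h1
    exact (p.smul_mem_iff (sub_ne_zero.2 hk.symm)).1 h1

/-- The weight of `x^α ∂/∂x_j` under `ad (x_k ∂/∂x_k)`. -/
noncomputable def wt (K : Type*) [Field K] {n : ℕ} (s : (_ : Fin n) × (Fin n →₀ ℕ)) (k : Fin n) : K :=
  s.2 k - (single s.1 1 k : ℕ)

theorem lie_torus_monoDer (k j : Fin n) (α : Fin n →₀ ℕ) :
    ⁅monoDer K (single k 1) k, monoDer K α j⁆ = wt K ⟨j, α⟩ k • monoDer K α j := by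
  have h1 : (α k : K) • monoDer K (single k 1 + (α - single k 1)) j =
      (α k : K) • monoDer K α j := by
    by_cases h : α k = 0
    · simp [h]
    · obtain ⟨γ, rfl⟩ := exists_add_single h
      rw [add_tsub_cancel_right, add_comm]
  have h2 : ((single k 1 : Fin n →₀ ℕ) j : K) • monoDer K (α + (single k 1 - single j 1)) k =
      ((single j 1 : Fin n →₀ ℕ) k : K) • monoDer K α j := by
    by_cases h : k = j
    · subst h
      simp
    · simp [h, Ne.symm h]
  rw [lie_monoDer, h1, h2]
  exact (sub_smul (α k : K) _ (monoDer K α j)).symm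

/-- The derivation `x^β ∑ j, c_j x_j ∂/∂x_j`. -/
noncomputable def torusMul (β : Fin n →₀ ℕ) (c : Fin n → K) : Wn K n :=
  ∑ j, c j • monoDer K (β + single j 1) j

/-- If a subalgebra containing the torus `⟨x_k ∂/∂x_k⟩` is not contained in a subspace `N`, then it
contains a weight vector outside `N`. The weight vectors are of the two forms below, according
to whether the weight has an entry `-1` or not. -/
theorem exists_weight_vector [CharZero K] {M : LieSubalgebra K (Wn K n)}
    (h0 : homog K n 0 ≤ M.toSubmodule) {N : Submodule K (Wn K n)} {D : Wn K n} (hD : D ∈ M)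
    (hDN : D ∉ N) :
    (∃ α j, α j = 0 ∧ monoDer K α j ∈ M ∧ monoDer K α j ∉ N) ∨
      ∃ (β : Fin n →₀ ℕ) (c : Fin n → K), torusMul β c ∈ M ∧ torusMul β c ∉ N := by
  classical
  set S := Finset.univ.sigma (fun j : Fin n => (D (X j)).support) with hS
  let v : (_ : Fin n) × (Fin n →₀ ℕ) → Wn K n := fun s => coeff s.2 (D (X s.1)) • monoDer K s.2 s.1
  have hsum : D = ∑ s ∈ S, v s := eq_sum_monoDer D
  have hmem (w : Fin n → K) : ∑ s ∈ S with wt K s = w, v s ∈ M.toSubmodule := by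
    refine sum_weight_mem (fun k => LieAlgebra.ad K (Wn K n) (monoDer K (single k 1) k))
      M.toSubmodule (fun k x hx => M.lie_mem (h0 (monoDer_mem_homog (by simp) k)) hx)
      (wt K) w S v (fun s k => ?_) (hsum ▸ hD)
    rw [map_smul, LieAlgebra.ad_apply, lie_torus_monoDer, smul_comm]
  obtain ⟨w, hw⟩ : ∃ w, ∑ s ∈ S with wt K s = w, v s ∉ N := by
    by_contra! hcon
    refine hDN ?_
    rw [hsum, ← Finset.sum_fiberwise_of_maps_to (g := wt K) (t := S.image (wt K))
      (fun s hs => Finset.mem_image_of_mem _ hs)]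
    exact N.sum_mem fun w _ => hcon w
  have hwt {s t : (_ : Fin n) × (Fin n →₀ ℕ)} (h : wt K s = wt K t) (k : Fin n) :
      s.2 k + single t.1 1 k = t.2 k + single s.1 1 k := by
    have := congrFun h k
    simp only [wt] at this
    have h' : (s.2 k : K) + (single t.1 1 k : ℕ) = t.2 k + (single s.1 1 k : ℕ) := by
      linear_combination this
    exact_mod_cast h'
  by_cases hcase : ∃ s ∈ S, wt K s = w ∧ s.2 s.1 = 0
  -- A weight with an entry `-1` at `j` occurs for only one monomial derivation.
  · obtain ⟨⟨j, α⟩, hs, hsw, hα⟩ := hcase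
    dsimp only at hα
    have hsing : S.filter (fun s => wt K s = w) = {⟨j, α⟩} := by
      refine Finset.eq_singleton_iff_unique_mem.2 ⟨Finset.mem_filter.2 ⟨hs, hsw⟩, ?_⟩
      rintro ⟨j', α'⟩ ht
      have h := hwt ((Finset.mem_filter.1 ht).2.trans hsw.symm)
      have hj : j' = j := by
        by_contra hne
        have := h j
        simp [hne, hα] at this
      subst hj
      have : α' = α := by
        ext k
        simpa using h k
      rw [this]
    have hM := hmem w
    rw [hsing, Finset.sum_singleton] at hw hM
    have hc : coeff α (D (X j)) ≠ 0 := fun h => hw (by simp [v, h])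
    exact Or.inl ⟨α, j, hα, (M.toSubmodule.smul_mem_iff hc).1 hM,
      fun h => hw (N.smul_mem _ h)⟩
  · push Not at hcase
    obtain ⟨⟨j₀, α₀⟩, hs₀⟩ : (S.filter (fun s => wt K s = w)).Nonempty := by
      by_contra hcon
      rw [Finset.not_nonempty_iff_eq_empty] at hcon
      exact hw (by rw [hcon, Finset.sum_empty]; exact N.zero_mem)
    rw [Finset.mem_filter] at hs₀
    obtain ⟨β, hβ⟩ := exists_add_single (hcase _ hs₀.1 hs₀.2)
    dsimp only at hβ
    subst hβ
    have hfib {s : (_ : Fin n) × (Fin n →₀ ℕ)} (hs : wt K s = w) : s.2 = β + single s.1 1 := by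
      ext k
      have := hwt (hs.trans hs₀.2.symm) k
      simp only [Finsupp.add_apply] at this ⊢
      omega
    have hwfib (j : Fin n) : wt K ⟨j, β + single j 1⟩ = w := by
      rw [← hs₀.2]
      funext k
      simp [wt]
    have heq : ∑ s ∈ S with wt K s = w, v s =
        torusMul β (fun j => coeff (β + single j 1) (D (X j))) := by
      rw [torusMul]
      refine Finset.sum_of_injOn Sigma.fst ?_ (fun _ _ => Finset.mem_univ _) ?_ ?_
      · rintro ⟨j, α⟩ hs ⟨j', α'⟩ hs' hjj
        have e := hfib (Finset.mem_filter.1 hs).2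
        have e' := hfib (Finset.mem_filter.1 hs').2
        dsimp only at hjj e e'
        subst hjj
        rw [e, e']
      · intro j _ hj
        have : coeff (β + single j 1) (D (X j)) = 0 := by
          by_contra hne
          refine hj ⟨⟨j, β + single j 1⟩, ?_, rfl⟩
          rw [Finset.mem_coe, Finset.mem_filter]
          refine ⟨?_, hwfib j⟩
          simp [hS, hne]
        rw [this, zero_smul]
      · rintro ⟨j, α⟩ hs
        have e := hfib (Finset.mem_filter.1 hs).2
        dsimp only at e
        rw [e]
    exact Or.inr ⟨β, _, heq ▸ hmem w, heq ▸ hw⟩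

theorem torusMul_one (β : Fin n →₀ ℕ) :
    torusMul β (1 : Fin n → K) = monomial β (1 : K) • euler K n := by
  refine MvPolynomial.derivation_ext fun k => ?_
  rw [Derivation.smul_apply, euler_apply_X, torusMul,
    ← Derivation.coeFnAddMonoidHom_apply (∑ _ ∈ _, _), map_sum, Finset.sum_apply]
  simp only [Pi.one_apply, one_smul, Derivation.coeFnAddMonoidHom_apply, monoDer_apply_X]
  simp [X, monomial_mul]

theorem torusMul_mem_homog {β : Fin n →₀ ℕ} {c : Fin n → K} {i : ℤ} (h : (β.degree : ℤ) = i) :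
    torusMul β c ∈ homog K n i :=
  Submodule.sum_mem _ fun j _ => Submodule.smul_mem _ _ (monoDer_mem_homog (by simp [h]) j)

theorem torusMul_single_one_mem (l : Fin n) :
    torusMul (single l 1) (1 : Fin n → K) ∈ eulerMultiples K n 1 := by
  refine ⟨torusMul_mem_homog (by simp), ?_⟩
  rw [torusMul_one]
  exact Submodule.smul_mem _ _ (Submodule.mem_span_singleton_self _)

theorem homog_neg_one_le : homog K n (-1) ≤ (projSubalgebra K n).toSubmodule :=
  le_sup_left.trans le_sup_left

theorem homog_zero_le : homog K n 0 ≤ (projSubalgebra K n).toSubmodule :=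
  le_sup_right.trans le_sup_left

theorem eulerMultiples_le : eulerMultiples K n 1 ≤ (projSubalgebra K n).toSubmodule :=
  le_sup_right

theorem degree_of_monoDer_notMem {α : Fin n →₀ ℕ} {j : Fin n}
    (h : monoDer K α j ∉ projSubalgebra K n) : 2 ≤ α.degree := by
  by_contra! hlt
  obtain h' | h' : α.degree = 0 ∨ α.degree = 1 := by omega
  · exact h (homog_neg_one_le (monoDer_mem_homog (by simp [h']) j))
  · exact h (homog_zero_le (monoDer_mem_homog (by simp [h']) j))

theorem torusMul_const (β : Fin n →₀ ℕ) (t : K) :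
    torusMul β (fun _ => t) = t • torusMul β (1 : Fin n → K) := by
  simp [torusMul, Finset.smul_sum]

theorem torusMul_const_mem {β : Fin n →₀ ℕ} (hβ : β.degree = 1) (t : K) :
    torusMul β (fun _ => t) ∈ projSubalgebra K n := by
  obtain ⟨γ, l, rfl, hγ⟩ := exists_add_single_of_degree hβ
  obtain rfl := (Finsupp.degree_eq_zero_iff γ).1 hγ
  rw [torusMul_const, zero_add]
  exact Submodule.smul_mem _ _ (eulerMultiples_le (torusMul_single_one_mem l))

/-! ### Consequences of containing an element of positive degree -/

section Generation

variable [CharZero K] {M : LieSubalgebra K (Wn K n)}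

/-- Bracketing with `x_a ∂/∂x_b`, `a ≠ j`, replaces a factor `x_b` by `x_a`. -/
theorem shift_mem (h0 : homog K n 0 ≤ M.toSubmodule) {γ : Fin n →₀ ℕ} {a b j : Fin n}
    (haj : a ≠ j) (h : monoDer K (γ + single b 1) j ∈ M) : monoDer K (γ + single a 1) j ∈ M := by
  have h1 := M.lie_mem (h0 (monoDer_mem_homog (α := single a 1) (by simp) b)) h
  rw [lie_monoDer] at h1
  simp only [Finsupp.add_apply, Finsupp.single_eq_same, add_tsub_cancel_right,
    Finsupp.single_eq_of_ne' haj, Nat.cast_zero, zero_smul, sub_zero] at h1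
  rw [add_comm]
  exact (M.toSubmodule.smul_mem_iff (Nat.cast_ne_zero.2 (Nat.succ_ne_zero _))).1 h1

theorem lower_mem (hm : homog K n (-1) ≤ M.toSubmodule) {γ : Fin n →₀ ℕ} {k j : Fin n}
    (h : monoDer K (γ + single k 1) j ∈ M) : monoDer K γ j ∈ M := by
  have h1 := M.lie_mem (hm (monoDer_mem_homog (α := 0) (by simp) k)) h
  rw [lie_monoDer] at h1
  simp only [Finsupp.add_apply, Finsupp.single_eq_same, add_tsub_cancel_right,
    Finsupp.coe_zero, Pi.zero_apply, Nat.cast_zero, zero_smul, sub_zero, zero_add] at h1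
  exact (M.toSubmodule.smul_mem_iff (Nat.cast_ne_zero.2 (Nat.succ_ne_zero _))).1 h1

/-- Lowering the degree to two and then replacing both factors by `x_a`. -/
theorem sq_mem_of_monoDer_mem (hm : homog K n (-1) ≤ M.toSubmodule)
    (h0 : homog K n 0 ≤ M.toSubmodule) {a j : Fin n} (haj : a ≠ j) {α : Fin n →₀ ℕ}
    (hα : 2 ≤ α.degree) (h : monoDer K α j ∈ M) :
    monoDer K (single a 1 + single a 1) j ∈ M := by
  obtain ⟨m, hm'⟩ : ∃ m, α.degree = m + 2 := ⟨α.degree - 2, by omega⟩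
  clear hα
  induction m generalizing α with
  | zero =>
    obtain ⟨γ, c, rfl, hγ⟩ := exists_add_single_of_degree hm'
    obtain ⟨δ, d, rfl, hδ⟩ := exists_add_single_of_degree hγ
    obtain rfl := (Finsupp.degree_eq_zero_iff δ).1 hδ
    have h1 := shift_mem h0 haj h
    rw [zero_add, add_comm] at h1
    exact shift_mem h0 haj h1
  | succ m ih =>
    obtain ⟨γ, c, rfl, hγ⟩ := exists_add_single_of_degree hm'
    exact ih (lower_mem hm h) hγ

/-- If `c_j ≠ c_i` then `ad (x_i ∂/∂x_j)` eventually turns `x^β ∑ c_k x_k ∂/∂x_k` into a multiple of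
a monomial derivation along `∂/∂x_j`. -/
theorem exists_monoDer_of_torusMul (h0 : homog K n 0 ≤ M.toSubmodule) {i j : Fin n} (hij : i ≠ j)
    {β : Fin n →₀ ℕ} {c : Fin n → K} (hc : c j ≠ c i) (h : torusMul β c ∈ M) :
    ∃ α : Fin n →₀ ℕ, α.degree = β.degree + 1 ∧ monoDer K α j ∈ M := by
  have hL : monoDer K (single i 1) j ∈ M := h0 (monoDer_mem_homog (by simp) j)
  have hlie (β : Fin n →₀ ℕ) (c : Fin n → K) : ⁅monoDer K (single i 1) j, torusMul β c⁆ =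
      ∑ k, c k • (((β + single k 1 : Fin n →₀ ℕ) j : K) •
          monoDer K (single i 1 + (β + single k 1 - single j 1)) k)
        - c i • monoDer K (β + single i 1) j := by
    have h1 : ⁅monoDer K (single i 1) j, torusMul β c⁆ =
        ∑ k, c k • ⁅monoDer K (single i 1) j, monoDer K (β + single k 1) k⁆ := by
      rw [torusMul, ← LieAlgebra.ad_apply K, map_sum]
      exact Finset.sum_congr rfl fun k _ => map_smul _ _ _
    simp only [h1, lie_monoDer, smul_sub, Finset.sum_sub_distrib]
    congr 1
    rw [Finset.sum_eq_single i]
    · simp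
    · intro k _ hk
      simp [hk.symm]
    · simp
  -- While `β_j > 0`, the bracket is again of the form `x^β' ∑ c'_k x_k ∂/∂x_k`, with
  -- `c'_j - c'_i = (β_j + 1) (c_j - c_i)` and `β'_j = β_j - 1`.
  induction hβ : β j generalizing β c with
  | zero =>
    refine ⟨β + single i 1, by simp, ?_⟩
    have h1 := M.lie_mem hL h
    rw [hlie, Finset.sum_eq_single j] at h1
    · simp only [Finsupp.add_apply, hβ, Finsupp.single_eq_same, zero_add, Nat.cast_one, one_smul,
        add_tsub_cancel_right] at h1
      rw [add_comm (single i 1)] at h1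
      exact (M.toSubmodule.smul_mem_iff (sub_ne_zero.2 hc)).1
        ((sub_smul (c j) (c i) (monoDer K (β + single i 1) j)).symm ▸ h1)
    · intro k _ hk
      simp [hβ, hk]
    · simp
  | succ m ih =>
    obtain ⟨γ, rfl⟩ := exists_add_single (α := β) (j := j) (by omega)
    have hγ : γ j = m := by simpa using hβ
    have h1 := M.lie_mem hL h
    have heq : ⁅monoDer K (single i 1) j, torusMul (γ + single j 1) c⁆ =
        torusMul (γ + single i 1)
          (fun k => (m + 1 : K) * c k + if k = j then c j - c i else 0) := by
      rw [hlie, torusMul]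
      have hlast : c i • monoDer K (γ + single j 1 + single i 1) j =
          ∑ k, (if k = j then c i else 0) • monoDer K (γ + single i 1 + single k 1) k := by
        rw [Finset.sum_eq_single j]
        · rw [if_pos rfl, add_right_comm]
        · intro k _ hk
          simp [hk]
        · simp
      rw [hlast, ← Finset.sum_sub_distrib]
      refine Finset.sum_congr rfl fun k _ => ?_
      rw [add_right_comm γ, add_tsub_cancel_right, ← add_assoc, add_comm (single i 1), smul_smul,
        ← sub_smul]
      congr 1
      by_cases hk : k = j
      · subst hk
        simp [hγ]
        ring
      · simp [hγ, hk]
        ring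
    rw [heq] at h1
    obtain ⟨α, hα, hαM⟩ := ih (β := γ + single i 1) (by
      simp only [hij, if_true, if_false, add_zero]
      intro hcon
      have h2 : (m + 2 : K) * (c j - c i) = 0 := by linear_combination hcon
      rcases mul_eq_zero.1 h2 with h3 | h3
      · exact (by positivity : (m + 2 : ℕ) ≠ 0) (by exact_mod_cast h3)
      · exact hc (sub_eq_zero.1 h3)) h1 (by simp [hγ, hij])
    exact ⟨α, by simpa using hα, hαM⟩

/-- The weight vectors outside `L` have positive degree. -/
theorem exists_weight_vector_of_not_le (h0 : homog K n 0 ≤ M.toSubmodule)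
    (hM : ¬ M ≤ projSubalgebra K n) :
    (∃ α j, α j = 0 ∧ 2 ≤ α.degree ∧ monoDer K α j ∈ M) ∨
      ∃ (β : Fin n →₀ ℕ) (c : Fin n → K), 1 ≤ β.degree ∧ torusMul β c ∈ M ∧
        torusMul β c ∉ projSubalgebra K n := by
  obtain ⟨D, hD, hDL⟩ := SetLike.not_le_iff_exists.1 hM
  rcases exists_weight_vector h0 hD (N := (projSubalgebra K n).toSubmodule) hDL with
    ⟨α, j, hα, h1, h2⟩ | ⟨β, c, h1, h2⟩
  · exact Or.inl ⟨α, j, hα, degree_of_monoDer_notMem h2, h1⟩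
  · refine Or.inr ⟨β, c, ?_, h1, h2⟩
    by_contra! hlt
    exact h2 (homog_zero_le (torusMul_mem_homog (by simpa using hlt)))

/-- For `n ≥ 2`, a subalgebra containing `W_n^{[-1]} + W_n^{[0]}` but not contained in `L` contains
a monomial derivation of positive degree. -/
theorem exists_monoDer_mem [Nontrivial (Fin n)] (hm : homog K n (-1) ≤ M.toSubmodule)
    (h0 : homog K n 0 ≤ M.toSubmodule) (hM : ¬ M ≤ projSubalgebra K n) :
    ∃ (α : Fin n →₀ ℕ) (j : Fin n), 2 ≤ α.degree ∧ monoDer K α j ∈ M := by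
  rcases exists_weight_vector_of_not_le h0 hM with ⟨α, j, _, h1, h2⟩ | ⟨β, c, hβ, h1, h2⟩
  · exact ⟨α, j, h1, h2⟩
  by_cases hc : ∃ i j, c j ≠ c i
  · obtain ⟨i, j, hij⟩ := hc
    obtain ⟨α, hα, hαM⟩ := exists_monoDer_of_torusMul h0 (i := i) (j := j)
      (fun h => hij (by rw [h])) hij h1
    exact ⟨α, j, by omega, hαM⟩
  push Not at hc
  obtain ⟨a, b, hab⟩ := exists_pair_ne (Fin n)
  have hconst : c = fun _ => c a := funext fun k => hc a k
  have hβ2 : 2 ≤ β.degree := by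
    by_contra! hlt
    exact h2 (hconst ▸ torusMul_const_mem (by omega) (c a))
  rw [hconst, torusMul_const] at h1 h2
  have hca : c a ≠ 0 := fun h => h2 (by rw [h, zero_smul]; exact Submodule.zero_mem _)
  have h1' : torusMul β (1 : Fin n → K) ∈ M := (M.toSubmodule.smul_mem_iff hca).1 h1
  -- `x^β E` is replaced by `⁅∂/∂x_b, x^β E⁆ = β_b x^{β - e_b} E + x^β ∂/∂x_b`, which is no multiple
  -- of `E`.
  have hb : (monoDer K 0 b : Wn K n) ∈ homog K n (-1) := monoDer_mem_homog (by simp) b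
  have h3 := M.lie_mem (hm hb) h1'
  have h4 : ⁅monoDer K 0 b, euler K n⁆ = monoDer K 0 b := by
    rw [← lie_skew, euler_lie hb]
    exact MvPolynomial.derivation_ext fun k => by simp
  have h5 : (monomial β (1 : K)) • monoDer K (0 : Fin n →₀ ℕ) b = monoDer K β b := by
    rw [monoDer, monoDer, smul_smul, monomial_mul]
    simp
  have h6 : monoDer K 0 b (monomial β (1 : K)) = (β b : K) • monomial (β - single b 1) 1 := by
    simp [monoDer, pderiv_monomial, smul_monomial]
  rw [torusMul_one, lie_smul_euler, h4, h5, h6, smul_assoc, ← torusMul_one] at h3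
  by_cases hβb : β b = 0
  · rw [hβb, Nat.cast_zero, zero_smul, zero_add] at h3
    exact ⟨β, b, hβ2, h3⟩
  · obtain ⟨γ, rfl⟩ := exists_add_single hβb
    have h7 : (((γ + single b 1 : Fin n →₀ ℕ) b : ℕ) : K) • torusMul γ (1 : Fin n → K) +
        monoDer K (γ + single b 1) b =
        torusMul γ (fun k => ((γ + single b 1 : Fin n →₀ ℕ) b : K) + if k = b then 1 else 0) := by
      simp only [torusMul, add_smul, Finset.sum_add_distrib, Finset.smul_sum, Pi.one_apply, one_smul,
        ite_smul, zero_smul, Finset.sum_ite_eq', Finset.mem_univ, if_true]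
    rw [add_tsub_cancel_right, h7] at h3
    obtain ⟨α, hα, hαM⟩ := exists_monoDer_of_torusMul h0 hab (by simp [hab]) h3
    simp only [map_add, Finsupp.degree_single] at hβ2
    exact ⟨α, b, by omega, hαM⟩

omit [CharZero K] in
theorem lie_monoDer_sq (b d : Fin n) :
    ⁅monoDer K (single b 1) d, monoDer K (single d 1 + single d 1) b⁆ =
      (2 : K) • monoDer K (single d 1 + single b 1) b - monoDer K (single d 1 + single d 1) d := by
  rw [lie_monoDer, add_tsub_cancel_right, add_comm (single b 1), tsub_self]
  norm_num

/-- The elements `x_c² ∂/∂x_d`, `c ≠ d`, generate each other over `W_n^{[0]}`. -/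
theorem sq_mem_of_sq_mem (hm : homog K n (-1) ≤ M.toSubmodule)
    (h0 : homog K n 0 ≤ M.toSubmodule) {a b c d : Fin n} (hab : a ≠ b) (hcd : c ≠ d)
    (h : monoDer K (single a 1 + single a 1) b ∈ M) :
    monoDer K (single c 1 + single c 1) d ∈ M := by
  by_cases hdb : d = b
  · subst hdb
    exact sq_mem_of_monoDer_mem hm h0 hcd (by simp) h
  have h1 := M.lie_mem (h0 (monoDer_mem_homog (α := single b 1) (by simp) d))
    (sq_mem_of_monoDer_mem hm h0 hdb (by simp) h)
  have h2 : (2 : K) • monoDer K (single d 1 + single b 1) b - monoDer K (single d 1 + single d 1) d =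
      torusMul (single d 1) (Pi.single b 2 + Pi.single d (-1)) := by
    simp only [torusMul, Pi.add_apply, add_smul, Finset.sum_add_distrib, Pi.single_apply, ite_smul,
      zero_smul, Finset.sum_ite_eq', Finset.mem_univ, if_true, neg_smul, one_smul, sub_eq_add_neg]
  rw [lie_monoDer_sq, h2] at h1
  obtain ⟨α, hα, hαM⟩ := exists_monoDer_of_torusMul h0 (i := b) (j := d) (Ne.symm hdb) (by
    simp only [Pi.add_apply, Pi.single_apply, hdb, Ne.symm hdb, if_true, if_false]
    norm_num) h1
  exact sq_mem_of_monoDer_mem hm h0 hcd (by simp [hα]) hαM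

omit [CharZero K] in
theorem succ_smul_eq_sub_sum_erase {V : Type*} [AddCommGroup V] [Module K V] (m : Fin n → V)
    (c : Fin n) : (n + 1 : K) • m c =
      (2 : K) • ∑ d, m d - ∑ d ∈ Finset.univ.erase c, ((2 : K) • m d - m c) := by
  have h := Finset.add_sum_erase Finset.univ (fun d => (2 : K) • m d - m c) (Finset.mem_univ c)
  have h2 : ∑ d, ((2 : K) • m d - m c) = (2 : K) • ∑ d, m d - (n : K) • m c := by
    rw [Finset.sum_sub_distrib, ← Finset.smul_sum, Finset.sum_const, Finset.card_univ,
      Fintype.card_fin, ← Nat.cast_smul_eq_nsmul K]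
  rw [eq_sub_of_add_eq' h, h2]
  module

/-- A subalgebra containing `L` and all `x_c² ∂/∂x_d`, `c ≠ d`, contains `W_n^{[1]}`. -/
theorem quadratic_mem (h0 : homog K n 0 ≤ M.toSubmodule)
    (h1 : eulerMultiples K n 1 ≤ M.toSubmodule)
    (hsq : ∀ c d : Fin n, c ≠ d → monoDer K (single c 1 + single c 1) d ∈ M)
    {α : Fin n →₀ ℕ} (hα : α.degree = 2) (j : Fin n) : monoDer K α j ∈ M := by
  have hdiff (c d : Fin n) (hcd : d ≠ c) : (2 : K) • monoDer K (single c 1 + single d 1) d -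
      monoDer K (single c 1 + single c 1) c ∈ M.toSubmodule := by
    rw [← lie_monoDer_sq]
    exact M.lie_mem (h0 (monoDer_mem_homog (by simp) c)) (hsq c d hcd.symm)
  -- Summing over `d ≠ c` and comparing with `2 x_c E` isolates `(n + 1) x_c² ∂/∂x_c`.
  have hcc (c : Fin n) : monoDer K (single c 1 + single c 1) c ∈ M.toSubmodule := by
    have hE := h1 (torusMul_single_one_mem (K := K) c)
    have hsum : ∑ d ∈ Finset.univ.erase c, ((2 : K) • monoDer K (single c 1 + single d 1) d -
        monoDer K (single c 1 + single c 1) c) ∈ M.toSubmodule :=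
      Submodule.sum_mem _ fun d hd => hdiff c d (Finset.ne_of_mem_erase hd)
    have heq : (n + 1 : K) • monoDer K (single c 1 + single c 1) c =
        (2 : K) • torusMul (single c 1) (1 : Fin n → K) -
          ∑ d ∈ Finset.univ.erase c, ((2 : K) • monoDer K (single c 1 + single d 1) d -
            monoDer K (single c 1 + single c 1) c) := by
      simp only [torusMul, Pi.one_apply, one_smul]
      exact succ_smul_eq_sub_sum_erase (K := K) (fun d => monoDer K (single c 1 + single d 1) d) c
    have hn : (n + 1 : K) ≠ 0 := by exact_mod_cast Nat.succ_ne_zero n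
    exact (M.toSubmodule.smul_mem_iff hn).1
      (heq ▸ sub_mem (M.toSubmodule.smul_mem _ hE) hsum)
  have hcd (c d : Fin n) : monoDer K (single c 1 + single d 1) d ∈ M.toSubmodule := by
    by_cases h : d = c
    · rw [h]
      exact hcc c
    · have h2 := add_mem (hdiff c d h) (hcc c)
      rw [sub_add_cancel] at h2
      exact (M.toSubmodule.smul_mem_iff two_ne_zero).1 h2
  obtain ⟨γ, x, rfl, hγ⟩ := exists_add_single_of_degree hα
  obtain ⟨δ, y, rfl, hδ⟩ := exists_add_single_of_degree hγ
  obtain rfl := (Finsupp.degree_eq_zero_iff δ).1 hδ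
  rw [zero_add]
  by_cases hx : x = j
  · rw [hx]
    exact hcd y j
  by_cases hy : y = j
  · rw [hy, add_comm]
    exact hcd x j
  · exact shift_mem h0 hx (hsq y j hy)

/-- Passage from degree `d` to `d + 1`: as `⁅x_l E, x^α ∂/∂x_j⁆` is a nonzero multiple of
`x_l x^α ∂/∂x_j` for `l ≠ j`, only the pure powers of `x_j` are left, and these come from a bracket
with `x_j ∂/∂x_k`. -/
theorem monoDer_mem_of_degree [Nontrivial (Fin n)] (h0 : homog K n 0 ≤ M.toSubmodule)
    (h1 : eulerMultiples K n 1 ≤ M.toSubmodule) {d : ℕ} (hd : 2 ≤ d)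
    (h : ∀ (α : Fin n →₀ ℕ) (j : Fin n), α.degree = d → monoDer K α j ∈ M)
    {α : Fin n →₀ ℕ} (hα : α.degree = d + 1) (j : Fin n) : monoDer K α j ∈ M := by
  have hne (α : Fin n →₀ ℕ) (hα : α.degree = d) (j l : Fin n) (hl : l ≠ j) :
      monoDer K (α + single l 1) j ∈ M.toSubmodule := by
    have h2 := M.lie_mem (h1 (torusMul_single_one_mem l)) (h α j hα)
    have h3 := euler_lie (K := K) (monoDer_mem_homog (α := α) (i := d - 1) (by simp [hα]) j)
    have h4 : monoDer K α j (X l) = 0 := by simp [monoDer_apply_X, hl]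
    have h5 : (monomial (single l 1) (1 : K)) • monoDer K α j = monoDer K (α + single l 1) j := by
      rw [monoDer, monoDer, smul_smul, monomial_mul, add_comm, one_mul]
    rw [torusMul_one, ← lie_skew, lie_smul_euler, ← X, h4, zero_smul, zero_add, ← lie_skew, h3,
      smul_neg, neg_neg, smul_comm, X, h5] at h2
    refine (M.toSubmodule.smul_mem_iff ?_).1 h2
    have : ((d : ℤ) - 1) ≠ 0 := by omega
    exact_mod_cast this
  by_cases hex : ∃ l, l ≠ j ∧ α l ≠ 0
  · obtain ⟨l, hl, hαl⟩ := hex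
    obtain ⟨β, rfl⟩ := exists_add_single hαl
    exact hne β (by simpa using hα) j l hl
  · push Not at hex
    obtain ⟨β, l, rfl, hβ⟩ := exists_add_single_of_degree hα
    have hl : l = j := by
      by_contra hl
      simpa using hex l hl
    subst hl
    obtain ⟨k, hk⟩ := exists_ne l
    have hβk : β k = 0 := by simpa [hk.symm] using hex k hk
    have h2 := M.lie_mem (h0 (monoDer_mem_homog (α := single l 1) (by simp) k)) (hne β hβ l k hk)
    rw [lie_monoDer, add_tsub_cancel_right] at h2
    simp only [Finsupp.add_apply, hβk, Finsupp.single_eq_same, zero_add, Nat.cast_one, one_smul,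
      tsub_self, add_zero] at h2
    have h3 : monoDer K (β + single k 1) k ∈ M.toSubmodule := by
      obtain ⟨e, rfl⟩ : ∃ e, d = e + 1 := ⟨d - 1, by omega⟩
      obtain ⟨δ, m, rfl, hδ⟩ := exists_add_single_of_degree hβ
      have hm : m ≠ k := by
        rintro rfl
        simp at hβk
      rw [add_right_comm]
      exact hne _ (by simp [hδ]) k m hm
    rw [add_comm]
    simpa using add_mem h2 h3

/-- For `n ≥ 2`, a subalgebra containing `L` properly is everything. -/
theorem eq_top_of_not_le [Nontrivial (Fin n)] (hm : homog K n (-1) ≤ M.toSubmodule)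
    (h0 : homog K n 0 ≤ M.toSubmodule) (h1 : eulerMultiples K n 1 ≤ M.toSubmodule)
    (hM : ¬ M ≤ projSubalgebra K n) : M = ⊤ := by
  obtain ⟨α, b, hα, hαM⟩ := exists_monoDer_mem hm h0 hM
  obtain ⟨a, hab⟩ := exists_ne b
  have hsq := sq_mem_of_monoDer_mem hm h0 hab hα hαM
  have hdeg (d : ℕ) : ∀ (α : Fin n →₀ ℕ) (j : Fin n), α.degree = d + 2 → monoDer K α j ∈ M := by
    induction d with
    | zero => exact fun α j h =>
        quadratic_mem h0 h1 (fun c d hcd => sq_mem_of_sq_mem hm h0 hab hcd hsq) h j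
    | succ d ih => exact fun α j h => monoDer_mem_of_degree h0 h1 (by omega) ih h j
  refine eq_top_of_monoDer_mem fun α j => ?_
  obtain h | h | ⟨d, h⟩ : α.degree = 0 ∨ α.degree = 1 ∨ ∃ d, α.degree = d + 2 := by
    rcases Nat.lt_or_ge α.degree 2 with h | h
    · omega
    · exact Or.inr (Or.inr ⟨α.degree - 2, by omega⟩)
  · exact hm (monoDer_mem_homog (by simp [h]) j)
  · exact h0 (monoDer_mem_homog (by simp [h]) j)
  · exact hdeg d α j h

/-- In contrast to `eq_top_of_not_le` this does not assume `N_1 ⊆ M`: already the divergence-free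
fields `x_a^k ∂/∂x_b` make `M` infinite-dimensional. -/
theorem not_finiteDimensional [Nontrivial (Fin n)] (hm : homog K n (-1) ≤ M.toSubmodule)
    (h0 : homog K n 0 ≤ M.toSubmodule) (hM : ¬ M ≤ projSubalgebra K n) :
    ¬ FiniteDimensional K M := by
  obtain ⟨α, b, hα, hαM⟩ := exists_monoDer_mem hm h0 hM
  obtain ⟨a, hab⟩ := exists_ne b
  have hsq := sq_mem_of_monoDer_mem hm h0 hab hα hαM
  have hH := M.lie_mem (h0 (monoDer_mem_homog (α := single b 1) (by simp) a)) hsq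
  rw [lie_monoDer_sq] at hH
  refine not_finiteDimensional_of_pow_mem a b 2 fun k => ?_
  induction k with
  | zero => simpa only [← Finsupp.single_add] using hsq
  | succ k ih =>
    have h1 := M.lie_mem hH ih
    have hlie : ⁅(2 : K) • monoDer K (single a 1 + single b 1) b -
        monoDer K (single a 1 + single a 1) a, monoDer K (single a (2 + k)) b⁆ =
        (-(k + 4) : K) • monoDer K (single a (2 + (k + 1))) b := by
      have e1 : single a 1 + single a 1 + (single a (2 + k) - single a 1) =
          single a (2 + (k + 1)) := by
        rw [← Finsupp.single_tsub, ← Finsupp.single_add, ← Finsupp.single_add]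
        congr 1
        omega
      have e2 : single a (2 + k) + (single a 1 + single b 1 - single b 1) =
          single a (2 + (k + 1)) := by
        rw [add_tsub_cancel_right, ← Finsupp.single_add]
        congr 1
      have e3 : ⁅(2 : K) • monoDer K (single a 1 + single b 1) b -
          monoDer K (single a 1 + single a 1) a, monoDer K (single a (2 + k)) b⁆ =
          (2 : K) • ⁅monoDer K (single a 1 + single b 1) b, monoDer K (single a (2 + k)) b⁆ -
          ⁅monoDer K (single a 1 + single a 1) a, monoDer K (single a (2 + k)) b⁆ := by
        exact (sub_lie _ _ _).trans (congrArg (fun D : Wn K n => D - _) (smul_lie _ _ _))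
      rw [e3, lie_monoDer, lie_monoDer, e1, e2]
      simp [hab.symm]
      module
    rw [hlie] at h1
    refine (M.toSubmodule.smul_mem_iff (neg_ne_zero.2 ?_)).1 h1
    exact_mod_cast Nat.succ_ne_zero (k + 3)

/-- For `n = 1`, where `N_1 = W_1^{[1]}` need not be assumed in `M`: some `x^m ∂/∂x` with `m ≥ 3`
lies in `M`, hence so do `x² ∂/∂x` and `x³ ∂/∂x`, which generate all higher degrees. -/
theorem eq_top_of_subsingleton [Subsingleton (Fin n)] (hm : homog K n (-1) ≤ M.toSubmodule)
    (h0 : homog K n 0 ≤ M.toSubmodule) (hM : ¬ M ≤ projSubalgebra K n) : M = ⊤ := by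
  obtain ⟨j, m, hj⟩ : ∃ (j : Fin n) (m : ℕ), monoDer K (single j (m + 3)) j ∈ M := by
    rcases exists_weight_vector_of_not_le h0 hM with ⟨α, j, hαj, h1, _⟩ | ⟨β, c, hβ, h1, h2⟩
    · have : α = 0 := Finsupp.ext fun k => by rw [Subsingleton.elim k j]; exact hαj
      simp [this] at h1
    · obtain ⟨γ, j, rfl, _⟩ := exists_add_single_of_degree (α := β) (d := β.degree - 1) (by omega)
      have hconst : c = fun _ => c j := funext fun k => by rw [Subsingleton.elim k j]
      have hsum : torusMul (γ + single j 1) c = c j • monoDer K (γ + single j 1 + single j 1) j :=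
        Fintype.sum_subsingleton _ j
      have hγ : γ j ≠ 0 := by
        intro h
        have : γ = 0 := Finsupp.ext fun k => by rw [Subsingleton.elim k j]; exact h
        exact h2 (hconst ▸ torusMul_const_mem (by simp [this]) (c j))
      have hcj : c j ≠ 0 := fun h => h2 (by rw [hsum, h, zero_smul]; exact Submodule.zero_mem _)
      refine ⟨j, γ j - 1, ?_⟩
      have : γ + single j 1 + single j 1 = single j (γ j - 1 + 3) := by
        ext k
        rw [Subsingleton.elim k j]
        simp only [Finsupp.add_apply, Finsupp.single_eq_same]
        omega
      rw [← this]
      exact (M.toSubmodule.smul_mem_iff hcj).1 (hsum ▸ h1)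
  have hlower (k : ℕ) (h : monoDer K (single j (k + 1)) j ∈ M) : monoDer K (single j k) j ∈ M :=
    lower_mem hm (Finsupp.single_add j k 1 ▸ h)
  have h3 : monoDer K (single j 3) j ∈ M := by
    induction m with
    | zero => exact hj
    | succ m ih => exact ih (hlower _ hj)
  have h2 : monoDer K (single j 2) j ∈ M := hlower 2 h3
  have hraise (m : ℕ) : monoDer K (single j (m + 3)) j ∈ M := by
    induction m with
    | zero => exact h3
    | succ m ih =>
      have h4 := M.lie_mem h2 ih
      have e1 : single j 2 + (single j (m + 3) - single j 1) = single j (m + 1 + 3) := by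
        rw [← Finsupp.single_tsub, ← Finsupp.single_add]
        congr 1
        omega
      have e2 : single j (m + 3) + (single j 2 - single j 1) = single j (m + 1 + 3) := by
        rw [← Finsupp.single_tsub, ← Finsupp.single_add]
      have e3 : ((m + 3 : ℕ) : K) • monoDer K (single j (m + 1 + 3)) j -
          ((2 : ℕ) : K) • monoDer K (single j (m + 1 + 3)) j =
          ((m + 1 : ℕ) : K) • monoDer K (single j (m + 1 + 3)) j := by
        push_cast
        module
      rw [lie_monoDer, e1, e2, Finsupp.single_eq_same, Finsupp.single_eq_same, e3] at h4
      exact (M.toSubmodule.smul_mem_iff (Nat.cast_ne_zero.2 (Nat.succ_ne_zero m))).1 h4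
  refine eq_top_of_monoDer_mem fun α k => ?_
  obtain rfl := Subsingleton.elim j k
  have hα : α = single j (α j) := Finsupp.ext fun l => by
    rw [Subsingleton.elim l j, Finsupp.single_eq_same]
  rw [hα]
  exact hlower _ (hlower _ (hlower _ (hraise (α j))))

end Generation

/-! ### Maximality and uniqueness -/

theorem monoDer_cube_notMem (j : Fin n) : monoDer K (single j 3) j ∉ projSubalgebra K n := by
  intro h
  obtain ⟨_, hab, c, hc, heq⟩ := Submodule.mem_sup.1 h
  obtain ⟨a, ha, b, hb, rfl⟩ := Submodule.mem_sup.1 hab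
  have hcoeff {i : ℤ} (hi : i < 2) {D : Wn K n} (hD : D ∈ homog K n i) :
      coeff (single j 3) (D (X j)) = 0 := by
    by_contra hne
    have := hD j _ hne
    simp at this
    omega
  have h1 : coeff (single j 3) ((a + b + c) (X j)) = 0 := by
    simp only [Derivation.add_apply, coeff_add, hcoeff (by norm_num) ha, hcoeff (by norm_num) hb,
      hcoeff (by norm_num) hc.1, add_zero]
  rw [heq, monoDer_apply_X] at h1
  simp at h1

/-- The subalgebra of derivations vanishing at the origin, that is, with no component in
`W_n^{[-1]}`. -/
noncomputable def vanishingAtZero (K : Type*) [Field K] (n : ℕ) : LieSubalgebra K (Wn K n) where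
  carrier := {D | ∀ j, constantCoeff (D (X j)) = 0}
  zero_mem' := by intro j; simp
  add_mem' := by
    intro D D' hD hD' j
    simp [hD j, hD' j]
  smul_mem' := by
    intro c D hD j
    simp [smul_eq_C_mul, hD j]
  lie_mem' := by
    intro D D' hD hD' j
    have key {D : Wn K n} (hD : ∀ j, constantCoeff (D (X j)) = 0) (p : MvPolynomial (Fin n) K) :
        constantCoeff (D p) = 0 := by
      induction p using MvPolynomial.induction_on with
      | C a => simp
      | add p q hp hq => simp [hp, hq]
      | mul_X p i hp => simp [hp, hD i]
    simp [Derivation.commutator_apply, key hD, key hD']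

theorem monoDer_mem_vanishingAtZero {α : Fin n →₀ ℕ} (hα : α ≠ 0) (j : Fin n) :
    monoDer K α j ∈ vanishingAtZero K n := by
  intro k
  rw [monoDer_apply_X]
  split_ifs
  · simp [constantCoeff_eq, coeff_monomial, hα]
  · simp

/-- A finite-dimensional maximal subalgebra containing `W_n^{[0]}` contains `W_n^{[-1]}`: otherwise
it would be the infinite-dimensional subalgebra of derivations vanishing at the origin. -/
theorem homog_neg_one_le_of_isCoatom [CharZero K] (hn : 1 ≤ n) {T : LieSubalgebra K (Wn K n)}
    (hfin : FiniteDimensional K T) (hT : IsCoatom T) (h0 : homog K n 0 ≤ T.toSubmodule) :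
    homog K n (-1) ≤ T.toSubmodule := by
  have hle : ¬ T ≤ vanishingAtZero K n := by
    intro hle
    rcases hT.le_iff.1 hle with htop | heq
    · have : monoDer K 0 ⟨0, hn⟩ ∈ vanishingAtZero K n := by
        rw [htop]
        trivial
      have := this ⟨0, hn⟩
      simp [monoDer_apply_X] at this
    · subst heq
      exact not_finiteDimensional_of_pow_mem ⟨0, hn⟩ ⟨0, hn⟩ 1
        (fun k => monoDer_mem_vanishingAtZero (by simp) _) hfin
  obtain ⟨D, hD, hDN⟩ := SetLike.not_le_iff_exists.1 hle
  rcases exists_weight_vector h0 hD (N := (vanishingAtZero K n).toSubmodule) hDN with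
    ⟨α, j, _, h1, h2⟩ | ⟨β, c, _, h2⟩
  · obtain rfl : α = 0 := by
      by_contra hα
      exact h2 (monoDer_mem_vanishingAtZero hα j)
    refine homog_le_iff.2 fun α k hα => ?_
    obtain rfl := (Finsupp.degree_eq_zero_iff α).1 (by omega)
    have h3 := T.lie_mem h1 (h0 (monoDer_mem_homog (α := single j 1) (by simp) k))
    rw [lie_monoDer] at h3
    simpa using h3
  · refine absurd (Submodule.sum_mem _ fun j _ => Submodule.smul_mem _ _ ?_) h2
    refine monoDer_mem_vanishingAtZero (fun h => ?_) j
    simpa using DFunLike.congr_fun h j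

theorem isCoatom_projSubalgebra [CharZero K] (hn : 1 ≤ n) : IsCoatom (projSubalgebra K n) := by
  refine ⟨fun h => monoDer_cube_notMem (K := K) (⟨0, hn⟩ : Fin n) (h ▸ LieSubalgebra.mem_top _),
    fun M hM => ?_⟩
  have hm := homog_neg_one_le.trans hM.le
  have h0 := homog_zero_le.trans hM.le
  rcases subsingleton_or_nontrivial (Fin n) with _ | _
  · exact eq_top_of_subsingleton hm h0 hM.not_ge
  · exact eq_top_of_not_le hm h0 (eulerMultiples_le.trans hM.le) hM.not_ge

theorem eq_projSubalgebra [CharZero K] (hn : 1 ≤ n) {T : LieSubalgebra K (Wn K n)}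
    (hfin : FiniteDimensional K T) (hT : IsCoatom T) (h0 : homog K n 0 ≤ T.toSubmodule) :
    T = projSubalgebra K n := by
  have hm := homog_neg_one_le_of_isCoatom hn hfin hT h0
  have hle : T ≤ projSubalgebra K n := by
    by_contra hle
    rcases subsingleton_or_nontrivial (Fin n) with _ | _
    · exact hT.1 (eq_top_of_subsingleton hm h0 hle)
    · exact not_finiteDimensional hm h0 hle hfin
  exact ((hT.le_iff.1 hle).resolve_left (isCoatom_projSubalgebra hn).1).symm

end Wn

theorem mainTheorem5 (K : Type*) [Field K] [IsAlgClosed K] [CharZero K] (n : ℕ) (hn : 1 ≤ n) :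
    iSupIndep ![Wn.homog K n (-1), Wn.homog K n 0, Wn.eulerMultiples K n 1] ∧
    ∃ L : LieSubalgebra K (Wn K n),
      L.toSubmodule = Wn.homog K n (-1) ⊔ Wn.homog K n 0 ⊔ Wn.eulerMultiples K n 1 ∧
      FiniteDimensional K L ∧
      IsCoatom L ∧
      ∀ T : LieSubalgebra K (Wn K n), FiniteDimensional K T → IsCoatom T →
        Wn.homog K n 0 ≤ T.toSubmodule → T = L :=
  ⟨Wn.iSupIndep_components, Wn.projSubalgebra K n, rfl, inferInstance,
    Wn.isCoatom_projSubalgebra hn, fun _ hfin hT h0 => Wn.eq_projSubalgebra hn hfin hT h0⟩
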